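/- Let $k$ be an algebraically closed field of characteristic $2$ or $3$ and let $E/k(T)$ be an elliptic curve. Call $E$ constant if it has a Weierstrass equation with coefficients in $k$. For a closed point $s\in\mathbb P^1_k$ with local ring $\mathcal O_s\subset k(T)$, say that $E$ has good reduction at $s$ if a minimal Weierstrass equation of $E$ over $\mathcal O_s$ has discriminant in $\mathcal O_s^\times$, and bad reduction at $s$ otherwise. Then: (a) if $j(E)\notin k$, then $E$ has bad reduction at at least two closed points of $\mathbb P^1_k$; (b) if $E$ is non-constant, then $E$ has bad reduction at at least one closed point of $\mathbb P^1_k$. Both bounds are sharp: for every algebraically closed field $k$ of characteristic $2$ or $3$, there is an elliptic curve over $k(T)$ with $j$-invariant not in $k$ and bad reduction at exactly two closed points of $\mathbb P^1_k$, and there is a non-constant elliptic curve over $k(T)$ with bad reduction at exactly one closed point of $\mathbb P^1_k$. -/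

import Mathlib

open Polynomial IsDedekindDomain

namespace EllipticP1

/-- The closed points of the projective line `ℙ¹` over `k`: the closed points of the affine line
`Spec k[T]`, i.e. the nonzero prime ideals of `k[T]`, together with the point at infinity. -/
inductive ClosedPoint (k : Type*) [Field k] : Type _
  | finite (p : HeightOneSpectrum k[X])
  | infinity

variable {k : Type*} [Field k]

open scoped Classical in
/-- The (multiplicatively written) normalized discrete valuation `ν_s` of `k(T)` attached to a
closed point `s` of `ℙ¹`: the `p`-adic valuation at a finite point `p`, and the valuation
with uniformizer `1 / T` at infinity. -/
noncomputable def ClosedPoint.valuation :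
    ClosedPoint k → Valuation (RatFunc k) (WithZero (Multiplicative ℤ))
  | .finite p => p.valuation (RatFunc k)
  | .infinity => RatFunc.inftyValuation k

/-- The local ring `𝒪_s ⊆ k(T)` of `ℙ¹` at a closed point `s`. -/
noncomputable abbrev ClosedPoint.localRing (s : ClosedPoint k) : ValuationSubring (RatFunc k) :=
  s.valuation.valuationSubring

instance ClosedPoint.isNontrivial_valuation (s : ClosedPoint k) :
    s.valuation.IsNontrivial := by
  cases s with
  | finite p =>
    change (p.valuation (RatFunc k)).IsNontrivial
    infer_instance
  | infinity =>
    classical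
    exact ⟨RatFunc.X, by simp [ClosedPoint.valuation]⟩

/-- The local ring at a closed point of `ℙ¹` is a discrete valuation ring. -/
instance ClosedPoint.isDiscreteValuationRing_localRing (s : ClosedPoint k) :
    IsDiscreteValuationRing s.localRing :=
  inferInstance

/-- An elliptic curve over `k(T)` has good reduction at the closed point `s` of `ℙ¹` if some
(equivalently, any) minimal Weierstrass equation for it over `𝒪_s` has good reduction, i.e. its
discriminant is a unit of `𝒪_s`. -/
def HasGoodReductionAt (E : WeierstrassCurve (RatFunc k)) (s : ClosedPoint k) : Prop :=
  ∃ C : WeierstrassCurve.VariableChange (RatFunc k), (C • E).HasGoodReduction s.localRing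

/-- The set of closed points of `ℙ¹` at which `E` has bad reduction. -/
def badPoints (E : WeierstrassCurve (RatFunc k)) : Set (ClosedPoint k) :=
  {s | ¬ HasGoodReductionAt E s}

/-- `E` is constant if it has a Weierstrass equation with coefficients in `k`. -/
def IsConstant (E : WeierstrassCurve (RatFunc k)) : Prop :=
  ∃ (C : WeierstrassCurve.VariableChange (RatFunc k)) (W : WeierstrassCurve k),
    C • E = W.map (algebraMap k (RatFunc k))

/-- `E` has constant `j`-invariant if `j(E) ∈ k`. -/
def HasConstantJ (E : WeierstrassCurve (RatFunc k)) [E.IsElliptic] : Prop :=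
  E.j ∈ Set.range (algebraMap k (RatFunc k))

end EllipticP1

/-!
# Places of bad reduction of elliptic curves over `k(T)` in characteristic 2 and 3

*Models.* Every rational function is the sum of one regular at a given point `s` of `ℙ¹` and one
regular away from `s` (partial fractions, `exists_add_of_closedPoint`). Hence a change of variables
that makes `E` smooth at `s` can be replaced by one that does nothing bad elsewhere, except at a
chosen point `s₀` that absorbs the degree of the scaling factor (`exists_smul_isSmoothAt`). Good
reduction away from `s₀` therefore gives one Weierstrass equation over the coordinate ring of
`ℙ¹ ∖ {s₀}`, with discriminant a unit there (`exists_smul_isSmoothAt_of_ne`). This ring is a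
polynomial ring over `k`, so the discriminant lies in `kˣ` (`exists_polynomial_model`).

*Good reduction everywhere implies constant.* An equation over `k[T]` with constant discriminant
needs no scaling at infinity, so it can be corrected there without spoiling any finite point. Its
coefficients are then regular on all of `ℙ¹`, hence constant
(`isConstant_of_forall_hasGoodReductionAt`). This holds in every characteristic.

*At most one bad point implies constant `j`.* It remains to see that a Weierstrass equation over
`k[X]` with discriminant in `kˣ` has constant `c₄`. In characteristic 3 (resp. 2) the Hasse
invariant is `b₂` (resp. `a₁`) and `c₄` is a power of it. As the discriminant is a cube (resp.
fourth power), the formula for it becomes, up to coprime factors, an equation between powers; it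
forces the Hasse invariant to be a cube (resp. sixteenth power) of some `D` satisfying
`N ^ q + α N D ^ (q - 1) + β = P D ^ q` with `q = 3` (resp. `q = 4`) and constants `α, β ≠ 0`. Such
an equation forces `D` to be a `q`-th power `D₁ ^ q`, with `D₁` satisfying an equation of the same
shape. By infinite descent on the degree, `D` is constant (`natDegree_eq_zero_of_pow_add_mul_eq`).

*Sharpness.* In characteristic 2 and 3 the curve `y² + xy = x³ + T` has discriminant `-T` and
`j = -1 / T`, so it is smooth away from `0` and `∞`. The curves `y² + y = x³ + Tx`
(characteristic 2) and `y² = x³ - x + T` (characteristic 3) have discriminant `1`, so they are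
smooth away from `∞`; good reduction at `∞` would make `f ^ q ± f + T` regular at `∞` for some `f`,
which a comparison of pole orders excludes.
-/

namespace EllipticP1

open WithZero WeierstrassCurve

variable {k : Type*} [Field k]

/-! ### Power equations between polynomials -/

/-- The exponents `n` and `n + 1` are coprime, so a factor `a ^ n` of an `(n + 1)`-st power that is
coprime to the cofactor comes from an `(n + 1)`-st power `a`; units are `(n + 1)`-st powers since
`k` is algebraically closed. -/
theorem exists_eq_pow_succ_of_pow_mul_eq [IsAlgClosed k] {a z u : k[X]}
    {n : ℕ} (h : a ^ n * z = u ^ (n + 1)) (haz : IsCoprime a z) :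
    ∃ w, a = w ^ (n + 1) := by
  classical
  by_cases ha : a = 0
  · exact ⟨0, by simp [ha]⟩
  obtain ⟨c, hc⟩ := exists_associated_pow_of_mul_eq_pow' (haz.pow_left (m := n)) h
  have hca : c ∣ a := by
    rw [← UniqueFactorizationMonoid.pow_dvd_pow_iff_dvd n.succ_ne_zero]
    exact hc.dvd.trans (pow_dvd_pow a n.le_succ)
  obtain ⟨d, hd⟩ := hca
  have key : Associated (d ^ (n + 1)) a := by
    have hc0 : c ^ (n + 1) ≠ 0 := pow_ne_zero _ (left_ne_zero_of_mul (hd ▸ ha))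
    refine Associated.of_mul_left ?_ hc hc0
    rw [← mul_pow, ← hd, ← pow_succ]
    exact .refl _
  obtain ⟨v, hv⟩ := key
  obtain ⟨r, hr, hrv⟩ := Polynomial.isUnit_iff.mp v.isUnit
  obtain ⟨y, hy⟩ := IsAlgClosed.exists_pow_nat_eq r n.succ_pos
  exact ⟨d * C y, by rw [mul_pow, ← C_pow, hy, hrv, hv]⟩

theorem isCoprime_of_add_eq_C {a b x y : k[X]} {c : k} (hc : c ≠ 0)
    (h : x * a + y * b = C c) : IsCoprime a b := by
  have hcc : C c * C c⁻¹ = (1 : k[X]) := by rw [← C_mul, mul_inv_cancel₀ hc, C_1]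
  exact ⟨C c⁻¹ * x, C c⁻¹ * y, by linear_combination C c⁻¹ * h + hcc⟩

/-- Infinite descent. Let `q = n + 1` be a power of the characteristic and `γ ^ q = -β`. The
equation reads `(N - γ) ^ q = D ^ (q - 1) * (P * D - α * N)` with coprime factors on the right, so
`D = D₁ ^ q` and `N = γ + D₁ ^ (q - 1) * N₁`, and `(N₁, D₁)` satisfies an equation of the same
shape, with `α * γ` in place of `β`. -/
theorem natDegree_eq_zero_of_pow_add_mul_eq [IsAlgClosed k] (p : ℕ) [Fact p.Prime]
    [CharP k p] {n r : ℕ} (hr : r ≠ 0) (hn : n + 1 = p ^ r) {α β : k} (hα : α ≠ 0)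
    (hβ : β ≠ 0) {N D P : k[X]}
    (h : N ^ (n + 1) + C α * N * D ^ n + C β = P * D ^ (n + 1)) : D.natDegree = 0 := by
  classical
  have hn0 : n ≠ 0 := by
    rintro rfl
    have := Nat.one_lt_pow hr (Fact.out : p.Prime).one_lt
    omega
  induction hd : D.natDegree using Nat.strong_induction_on generalizing D N P β with
  | _ d ih =>
  obtain ⟨γ, hγ⟩ := IsAlgClosed.exists_pow_nat_eq (-β) n.succ_pos
  have hγ0 : γ ≠ 0 := by
    rintro rfl
    simp [eq_comm, hβ] at hγ
  have hfrob : (N - C γ) ^ (n + 1) = N ^ (n + 1) + C β := by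
    rw [hn, sub_pow_char_pow, ← hn, ← C_pow, hγ]; simp
  have h1 : D ^ n * (P * D - C α * N) = (N - C γ) ^ (n + 1) := by
    rw [hfrob]; linear_combination -h
  have hcop : IsCoprime D N := by
    obtain ⟨m, rfl⟩ : ∃ m, n = m + 1 := Nat.exists_eq_succ_of_ne_zero hn0
    exact isCoprime_of_add_eq_C (x := P * D ^ (m + 1) - C α * N * D ^ m) (y := -N ^ (m + 1)) hβ
      (by linear_combination -h)
  have hcop2 : IsCoprime D (P * D - C α * N) := by
    have ha : C α * C α⁻¹ = (1 : k[X]) := by rw [← C_mul, mul_inv_cancel₀ hα, C_1]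
    obtain ⟨x, y, hxy⟩ := hcop
    exact ⟨x + y * C α⁻¹ * P, -y * C α⁻¹, by linear_combination hxy + y * N * ha⟩
  obtain ⟨D₁, rfl⟩ := exists_eq_pow_succ_of_pow_mul_eq h1 hcop2
  by_cases hD : D₁ = 0
  · simp [← hd, hD]
  obtain ⟨N₁, hN₁⟩ : D₁ ^ n ∣ N - C γ := by
    rw [← UniqueFactorizationMonoid.pow_dvd_pow_iff_dvd n.succ_ne_zero, ← h1]
    exact ⟨P * D₁ ^ (n + 1) - C α * N, by rw [Nat.succ_eq_add_one]; ring⟩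
  have h2 : N₁ ^ (n + 1) + C α * N₁ * D₁ ^ n + C (α * γ) = P * D₁ ^ (n + 1) := by
    have hne : (D₁ ^ (n + 1)) ^ n ≠ 0 := pow_ne_zero _ (pow_ne_zero _ hD)
    refine mul_left_cancel₀ hne ?_
    rw [hN₁] at h1
    rw [C_mul]
    linear_combination -h1 - C α * (D₁ ^ (n + 1)) ^ n * hN₁
  rw [natDegree_pow] at hd
  rcases Nat.eq_zero_or_pos D₁.natDegree with h0 | h0
  · rw [← hd, h0, mul_zero]
  · have hlt : D₁.natDegree < d := by rw [← hd]; nlinarith [Nat.pos_of_ne_zero hn0]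
    have := ih D₁.natDegree hlt (mul_ne_zero hα hγ0) h2 rfl
    omega

/-! ### Weierstrass equations over `k[X]` with constant discriminant -/

/-- In characteristic 3 the discriminant is `b₄ ^ 3 - b₂ ^ 2 * (b₂ * b₆ - b₄ ^ 2)`. Writing it as
`e ^ 3` yields `b₂ = w ^ 3` and `b₄ = e + w ^ 2 * y`, and then a descent equation for `(y, w)`. -/
theorem natDegree_b₂_eq_zero_of_charP_three [IsAlgClosed k] [CharP k 3] {W : WeierstrassCurve k[X]}
    {c : k} (hc : c ≠ 0) (hΔ : W.Δ = C c) : W.b₂.natDegree = 0 := by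
  have h3 : (3 : k[X]) = 0 := CharP.cast_eq_zero k[X] 3
  have : Fact (Nat.Prime 3) := ⟨Nat.prime_three⟩
  obtain ⟨e, rfl⟩ := IsAlgClosed.exists_pow_nat_eq c (n := 3) (by norm_num)
  have he : e ≠ 0 := by rintro rfl; simp at hc
  rw [C_pow] at hΔ
  have h1 : W.b₂ ^ 2 * (W.b₂ * W.b₆ - W.b₄ ^ 2) = (W.b₄ - C e) ^ (2 + 1) := by
    have hb8 := W.b_relation
    have hD : W.Δ = -W.b₂ ^ 2 * W.b₈ - 8 * W.b₄ ^ 3 - 27 * W.b₆ ^ 2 + 9 * W.b₂ * W.b₄ * W.b₆ := rfl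
    grind
  have hcop : IsCoprime W.b₂ (W.b₂ * W.b₆ - W.b₄ ^ 2) := by
    have h : IsCoprime W.b₂ W.b₄ :=
      isCoprime_of_add_eq_C (x := -W.b₂ * (W.b₂ * W.b₆ - W.b₄ ^ 2)) (y := W.b₄ ^ 2)
        (pow_ne_zero 3 he) (by rw [C_pow]; grind)
    rw [sub_eq_neg_add]
    exact (h.pow_right (n := 2)).neg_right.add_mul_left_right _
  obtain ⟨w, hw⟩ := exists_eq_pow_succ_of_pow_mul_eq h1 hcop
  by_cases hw0 : w = 0
  · simp [hw, hw0]
  obtain ⟨y, hy⟩ : w ^ 2 ∣ W.b₄ - C e := by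
    rw [← UniqueFactorizationMonoid.pow_dvd_pow_iff_dvd (n := 3) (by norm_num), ← h1, hw]
    exact ⟨w ^ (2 + 1) * W.b₆ - W.b₄ ^ 2, by ring⟩
  have h2 : y ^ (2 + 1) + C (2 * e) * y * w ^ 2 + C (e ^ 2) = (W.b₆ - w * y ^ 2) * w ^ (2 + 1) := by
    have hne : (w ^ (2 + 1)) ^ 2 ≠ 0 := pow_ne_zero _ (pow_ne_zero _ hw0)
    refine mul_left_cancel₀ hne ?_
    rw [hy, hw] at h1
    have hb4 : W.b₄ = C e + w ^ 2 * y := by linear_combination hy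
    rw [hb4] at h1
    simp only [C_mul, C_pow, C_ofNat]
    linear_combination -h1
  have h20 : (2 : k) ≠ 0 := by
    intro h
    have h3 : (3 : k) = 0 := CharP.cast_eq_zero k 3
    exact one_ne_zero (α := k) (by linear_combination h3 - h)
  have := natDegree_eq_zero_of_pow_add_mul_eq 3 (r := 1) one_ne_zero (by norm_num)
    (mul_ne_zero h20 he) (pow_ne_zero 2 he) h2
  rw [hw, natDegree_pow, this]

/-- In characteristic 2 the discriminant is a fourth power `e ^ 4`, and it equals `a₃ ^ 4` up to a
multiple of `a₁ ^ 3`. Extracting fourth roots once and square roots twice yields `a₁ = D ^ 16` and a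
descent equation for `D`. -/
theorem natDegree_a₁_eq_zero_of_charP_two [IsAlgClosed k] [CharP k 2] {W : WeierstrassCurve k[X]}
    {c : k} (hc : c ≠ 0) (hΔ : W.Δ = C c) : W.a₁.natDegree = 0 := by
  have h2 : (2 : k[X]) = 0 := CharP.cast_eq_zero k[X] 2
  have : Fact (Nat.Prime 2) := ⟨Nat.prime_two⟩
  obtain ⟨e, rfl⟩ := IsAlgClosed.exists_pow_nat_eq c (n := 4) (by norm_num)
  have he : e ≠ 0 := by rintro rfl; simp at hc
  obtain ⟨f, hf⟩ := IsAlgClosed.exists_pow_nat_eq (e ^ 3) (n := 4) (by norm_num)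
  have hf0 : f ≠ 0 := by
    rintro rfl
    exact pow_ne_zero 3 he (by rw [← hf]; simp)
  have hff : C f ^ 4 = (C e ^ 3 : k[X]) := by rw [← C_pow, hf, C_pow]
  rw [C_pow] at hΔ
  obtain ⟨a, a₂, δ, a₄, a₆⟩ := W
  simp only
  have h1 : a ^ 3 * (δ ^ 3 + a * (a ^ 2 * a₆ + a * δ * a₄ + a₂ * δ ^ 2 + a₄ ^ 2)) =
      (δ - C e) ^ (3 + 1) := by
    simp only [WeierstrassCurve.Δ, WeierstrassCurve.b₂, WeierstrassCurve.b₄, WeierstrassCurve.b₆,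
      WeierstrassCurve.b₈] at hΔ
    grind
  have hcop : IsCoprime a (δ ^ 3 + a * (a ^ 2 * a₆ + a * δ * a₄ + a₂ * δ ^ 2 + a₄ ^ 2)) := by
    have h : IsCoprime a δ :=
      isCoprime_of_add_eq_C (x := -a ^ 2 * (δ ^ 3 + a * (a ^ 2 * a₆ + a * δ * a₄ + a₂ * δ ^ 2 +
        a₄ ^ 2))) (y := δ ^ 3) (pow_ne_zero 4 he) (by rw [C_pow]; grind)
    exact (h.pow_right (n := 3)).add_mul_left_right _
  obtain ⟨A, rfl⟩ := exists_eq_pow_succ_of_pow_mul_eq h1 hcop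
  by_cases hA0 : A = 0
  · simp [hA0]
  obtain ⟨W, hW⟩ : A ^ 3 ∣ δ - C e := by
    rw [← UniqueFactorizationMonoid.pow_dvd_pow_iff_dvd (n := 4) (by norm_num), ← h1]
    exact ⟨δ ^ 3 + A ^ (3 + 1) * ((A ^ (3 + 1)) ^ 2 * a₆ + A ^ (3 + 1) * δ * a₄ + a₂ * δ ^ 2 +
      a₄ ^ 2), by ring⟩
  obtain rfl : δ = C e + A ^ 3 * W := by linear_combination hW
  clear hcop hΔ
  set E : k[X] := C e with hE
  set F : k[X] := C f with hF
  -- the shape of `Z` plays no role from here on; it ends up in the coefficient `P`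
  obtain ⟨Z, hZ⟩ : ∃ Z, Z = (A ^ 4) ^ 2 * a₆ + A ^ 4 * (E + A ^ 3 * W) * a₄ +
    a₂ * (E + A ^ 3 * W) ^ 2 := ⟨_, rfl⟩
  have h3 : W ^ 4 = (E + A ^ 3 * W) ^ 3 + A ^ 4 * (Z + a₄ ^ 2) := by
    have hne : (A ^ 3) ^ 4 ≠ 0 := pow_ne_zero _ (pow_ne_zero _ hA0)
    refine mul_left_cancel₀ hne ?_
    rw [hZ]
    linear_combination -h1
  clear h1 hZ
  -- complete `W ^ 4 - E ^ 3` to the fourth power `(W + F) ^ 4` and absorb `A ^ 4 * a₄ ^ 2`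
  obtain ⟨M, hM⟩ : ∃ M, M = E ^ 2 * W + A * (A ^ 5 * W ^ 3 + A ^ 2 * W ^ 2 * E + Z) := ⟨_, rfl⟩
  have h4 : A ^ 3 * M = ((W + F) ^ 2 + A ^ 2 * a₄) ^ 2 := by grind
  -- a common zero of `A` and `M` would be a zero of `W`, hence of `E ^ 3`
  have hcop : IsCoprime A M := by
    have h : IsCoprime A W :=
      isCoprime_of_add_eq_C (pow_ne_zero 3 he) (x := -(A ^ 2 * M - A ^ 3 * a₄ ^ 2)) (y := W ^ 3)
        (by rw [C_pow, ← hE]; grind)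
    have hAE : IsCoprime A (E ^ 2) := by
      rw [hE, ← C_pow]
      exact isCoprime_of_add_eq_C (x := 0) (y := 1) (pow_ne_zero 2 he) (by ring)
    rw [hM]
    exact (hAE.mul_right h).add_mul_left_right _
  -- `A` divides a square with coprime cofactor `M`, up to a square, so it is a square `B ^ 2`;
  -- the same argument applied to `h7` makes `B` a square `D ^ 2`
  obtain ⟨X₁, hX₁⟩ : A ∣ (W + F) ^ 2 + A ^ 2 * a₄ := by
    rw [← UniqueFactorizationMonoid.pow_dvd_pow_iff_dvd two_ne_zero, ← h4]
    exact ⟨A * M, by ring⟩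
  have h5 : A ^ 1 * M = X₁ ^ (1 + 1) := by
    refine mul_left_cancel₀ (pow_ne_zero 2 hA0) ?_
    rw [hX₁] at h4
    linear_combination h4
  obtain ⟨B, rfl⟩ := exists_eq_pow_succ_of_pow_mul_eq h5 hcop
  have hB0 : B ≠ 0 := by rintro rfl; simp at hA0
  obtain ⟨V, rfl⟩ : B ∣ X₁ := by
    rw [← UniqueFactorizationMonoid.pow_dvd_pow_iff_dvd two_ne_zero]
    exact ⟨M, by linear_combination -h5⟩
  have h6 : M = V ^ 2 := by
    refine mul_left_cancel₀ (pow_ne_zero 2 hB0) ?_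
    linear_combination h5
  have hcop' : IsCoprime B (V + B * a₄) := by
    rw [h6, IsCoprime.pow_left_iff (Nat.succ_pos 1), IsCoprime.pow_right_iff two_pos] at hcop
    exact hcop.add_mul_left_right _
  have h7 : B ^ 3 * (V + B * a₄) = (W + F) ^ 2 := by
    linear_combination -hX₁ + h2 * B ^ 4 * a₄
  obtain ⟨Y, hY⟩ : B ∣ W + F := by
    rw [← UniqueFactorizationMonoid.pow_dvd_pow_iff_dvd two_ne_zero, ← h7]
    exact ⟨B * (V + B * a₄), by ring⟩
  have h8 : B ^ 1 * (V + B * a₄) = Y ^ (1 + 1) := by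
    refine mul_left_cancel₀ (pow_ne_zero 2 hB0) ?_
    rw [hY] at h7
    linear_combination h7
  obtain ⟨D, rfl⟩ := exists_eq_pow_succ_of_pow_mul_eq h8 hcop'
  have hD0 : D ≠ 0 := by rintro rfl; simp at hB0
  obtain ⟨U, rfl⟩ : D ∣ Y := by
    rw [← UniqueFactorizationMonoid.pow_dvd_pow_iff_dvd two_ne_zero]
    exact ⟨V + D ^ (1 + 1) * a₄, by linear_combination -h8⟩
  have h9 : V + D ^ 2 * a₄ = U ^ 2 := by
    refine mul_left_cancel₀ (pow_ne_zero 2 hD0) ?_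
    linear_combination h8
  obtain rfl : W = D ^ 3 * U - F := by linear_combination hY
  obtain ⟨P, hP⟩ : ∃ P, U ^ (3 + 1) + C (e ^ 2) * U * D ^ 3 + C (e ^ 2 * f) = P * D ^ (3 + 1) := by
    rw [C_mul, C_pow, ← hE, ← hF]
    exact ⟨(D ^ 4) ^ 5 * (D ^ 3 * U - F) ^ 3 + (D ^ 4) ^ 2 * (D ^ 3 * U - F) ^ 2 * E + Z + a₄ ^ 2,
      by linear_combination -(U ^ 2 + V + D ^ 2 * a₄) * h9 - h6 + hM +
        h2 * (E ^ 2 * U * D ^ 3 + V * D ^ 2 * a₄)⟩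
  have := natDegree_eq_zero_of_pow_add_mul_eq 2 (r := 2) two_ne_zero (by norm_num)
    (pow_ne_zero 2 he) (mul_ne_zero (pow_ne_zero 2 he) hf0) hP
  simp [natDegree_pow, this]

/-! ### Rational functions on the projective line -/

/-- The closed point `T = t` of the affine line, as a prime ideal of `k[X]`. -/
noncomputable def linearPrime (t : k) : HeightOneSpectrum k[X] where
  asIdeal := Ideal.span {X - C t}
  isPrime := (Ideal.span_singleton_prime (X_sub_C_ne_zero t)).mpr (prime_X_sub_C t)
  ne_bot := by simpa using X_sub_C_ne_zero t

theorem mem_linearPrime {t : k} {f : k[X]} : f ∈ (linearPrime t).asIdeal ↔ f.eval t = 0 := by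
  rw [linearPrime, Ideal.mem_span_singleton, dvd_iff_isRoot, IsRoot]

theorem linearPrime_injective : Function.Injective (linearPrime (k := k)) := fun t t' h => by
  have : X - C t ∈ (linearPrime t').asIdeal := h ▸ mem_linearPrime.mpr (by simp)
  simpa [mem_linearPrime, sub_eq_zero, eq_comm] using this

theorem exists_eq_linearPrime [IsAlgClosed k] (p : HeightOneSpectrum k[X]) :
    ∃ t, p = linearPrime t := by
  obtain ⟨g, hg⟩ := (IsPrincipalIdealRing.principal p.asIdeal).principal
  rw [Ideal.submodule_span_eq] at hg
  have hg0 : g ≠ 0 := by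
    rintro rfl
    exact p.ne_bot (by simpa using hg)
  have hgp : Prime g := (Ideal.span_singleton_prime hg0).mp (hg ▸ p.isPrime)
  obtain ⟨t, ht⟩ := IsAlgClosed.exists_root g
    (by rw [IsAlgClosed.degree_eq_one_of_irreducible k hgp.irreducible]; exact one_ne_zero)
  refine ⟨t, HeightOneSpectrum.ext ?_⟩
  rw [hg, linearPrime, Ideal.span_singleton_eq_span_singleton]
  exact (Irreducible.associated_of_dvd (irreducible_X_sub_C t) hgp.irreducible
    (dvd_iff_isRoot.mpr ht)).symm

theorem linearPrime_valuation_X_sub_C (t : k) :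
    (linearPrime t).valuation (RatFunc k) (algebraMap k[X] (RatFunc k) (X - C t)) = exp (-1) := by
  rw [HeightOneSpectrum.valuation_of_algebraMap]
  exact HeightOneSpectrum.intValuation_singleton _ (X_sub_C_ne_zero t) rfl

theorem valuation_infinity_algebraMap {f : k[X]} (hf : f ≠ 0) :
    (ClosedPoint.infinity : ClosedPoint k).valuation (algebraMap k[X] (RatFunc k) f) =
      exp (f.natDegree : ℤ) := by
  classical
  exact RatFunc.inftyValuation.polynomial k hf

theorem valuation_finite_algebraMap_le_one (p : HeightOneSpectrum k[X]) (f : k[X]) :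
    (ClosedPoint.finite p).valuation (algebraMap k[X] (RatFunc k) f) ≤ 1 :=
  p.valuation_le_one f

theorem valuation_finite_algebraMap_eq_one {p : HeightOneSpectrum k[X]} {f : k[X]} :
    (ClosedPoint.finite p).valuation (algebraMap k[X] (RatFunc k) f) = 1 ↔ f ∉ p.asIdeal :=
  HeightOneSpectrum.valuation_eq_one_iff_notMem ..

theorem finite_setOf_valuation_ne_one {f : RatFunc k} (hf : f ≠ 0) :
    {s : ClosedPoint k | s.valuation f ≠ 1}.Finite := by
  have h := (HeightOneSpectrum.Support.finite (R := k[X]) f).union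
    (HeightOneSpectrum.Support.finite (R := k[X]) f⁻¹)
  refine ((h.image ClosedPoint.finite).insert .infinity).subset fun s hs => ?_
  cases s with
  | infinity => exact Set.mem_insert _ _
  | finite p =>
    refine Set.mem_insert_of_mem _ ⟨p, ?_, rfl⟩
    have hs : p.valuation (RatFunc k) f ≠ 1 := hs
    rcases lt_or_gt_of_ne hs with h | h
    · right
      change 1 < p.valuation (RatFunc k) f⁻¹
      rw [map_inv₀]
      exact (one_lt_inv₀ (by simpa [zero_lt_iff] using hf)).mpr h
    · exact Or.inl h

/-- For `s ≠ s₀` there is a rational function with divisor `s - s₀`: a local parameter at `s`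
without zeros or poles outside `{s, s₀}`. -/
theorem exists_uniformizer [IsAlgClosed k] {s s₀ : ClosedPoint k} (h : s ≠ s₀) :
    ∃ π : RatFunc k, s.valuation π = exp (-1) ∧
      ∀ s', s' ≠ s → s' ≠ s₀ → s'.valuation π = 1 := by
  -- `π` is a quotient of two functions with divisors `s - ∞` and `s₀ - ∞`
  have key : ∀ s : ClosedPoint k, ∃ π : RatFunc k, (s ≠ .infinity → s.valuation π = exp (-1)) ∧
      (s ≠ .infinity → ClosedPoint.infinity.valuation π = exp 1) ∧
      (∀ s', s' ≠ s → s' ≠ .infinity → s'.valuation π = 1) ∧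
      (s = .infinity → π = 1) := by
    intro s
    cases s with
    | infinity => exact ⟨1, by simp⟩
    | finite p =>
      obtain ⟨t, rfl⟩ := exists_eq_linearPrime p
      refine ⟨algebraMap k[X] (RatFunc k) (X - C t), fun _ => linearPrime_valuation_X_sub_C t,
        fun _ => by rw [valuation_infinity_algebraMap (X_sub_C_ne_zero t)]; simp, ?_, by simp⟩
      rintro (p' | _) h1 h2
      · obtain ⟨t', rfl⟩ := exists_eq_linearPrime p'
        rw [valuation_finite_algebraMap_eq_one, mem_linearPrime]
        rw [ne_eq, ClosedPoint.finite.injEq, linearPrime_injective.eq_iff] at h1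
        simpa [sub_eq_zero] using h1
      · exact absurd rfl h2
  obtain ⟨π, h1, h2, h3, h4⟩ := key s
  obtain ⟨ρ, h1', h2', h3', h4'⟩ := key s₀
  refine ⟨π / ρ, ?_, fun s' hs hs₀ => ?_⟩
  · rw [map_div₀]
    by_cases hs : s = .infinity
    · rw [h4 hs, hs, h2' (hs ▸ h.symm), map_one, exp_neg, one_div]
    · rw [h1 hs, h3' s h hs, div_one]
  · rw [map_div₀]
    by_cases hs' : s' = .infinity
    · rw [hs', h2 (hs' ▸ hs.symm), h2' (hs' ▸ hs₀.symm), div_self exp_ne_zero]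
    · rw [h3 s' hs hs', h3' s' hs₀ hs', div_one]

theorem valuation_infinity_div_le_one {r d : k[X]} (hd : d ≠ 0) (h : r.degree ≤ d.degree) :
    ClosedPoint.infinity.valuation (algebraMap k[X] (RatFunc k) r / algebraMap k[X] (RatFunc k) d)
      ≤ 1 := by
  rcases eq_or_ne r 0 with rfl | hr
  · simp
  rw [map_div₀, valuation_infinity_algebraMap hr, valuation_infinity_algebraMap hd]
  rw [div_le_one₀ (by simp), exp_le_exp]
  exact_mod_cast natDegree_le_natDegree h

/-- Partial fractions: a rational function is the sum of a function regular at `s` and a principal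
part at `s`, which is regular away from `s`. -/
theorem exists_add_of_closedPoint [IsAlgClosed k] (s : ClosedPoint k) (f : RatFunc k) :
    ∃ g h, f = g + h ∧ s.valuation g ≤ 1 ∧ ∀ s', s' ≠ s → s'.valuation h ≤ 1 := by
  obtain ⟨n, d, hd, rfl⟩ := IsFractionRing.div_surjective (A := k[X]) f
  have hd0 : d ≠ 0 := nonZeroDivisors.ne_zero hd
  have hdK : algebraMap k[X] (RatFunc k) d ≠ 0 := by simpa using hd0
  cases s with
  | infinity =>
    refine ⟨algebraMap _ _ (n % d) / algebraMap _ _ d, algebraMap _ _ (n / d), ?_,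
      valuation_infinity_div_le_one hd0 (EuclideanDomain.mod_lt n hd0).le, ?_⟩
    · rw [div_add' _ _ _ hdK, ← map_mul, ← map_add, mul_comm, EuclideanDomain.mod_add_div]
    · rintro (p | _) h
      · exact valuation_finite_algebraMap_le_one _ _
      · exact absurd rfl h
  | finite p =>
    obtain ⟨t, rfl⟩ := exists_eq_linearPrime p
    obtain ⟨d', hd', hdd'⟩ := exists_eq_pow_rootMultiplicity_mul_and_not_dvd d hd0 t
    set m := rootMultiplicity t d
    have hcop : IsCoprime ((X - C t) ^ m) d' :=
      (((irreducible_X_sub_C t).coprime_iff_not_dvd).mpr hdd').pow_left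
    obtain ⟨a, b, hab⟩ := hcop
    have hq0 : (X - C t) ^ m ≠ 0 := pow_ne_zero _ (X_sub_C_ne_zero t)
    set q := (X - C t) ^ m with hq
    have hd'0 : d' ≠ 0 := by rintro rfl; simp at hdd'
    have hqK : algebraMap k[X] (RatFunc k) q ≠ 0 := by simpa using hq0
    have hd'K : algebraMap k[X] (RatFunc k) d' ≠ 0 := by simpa using hd'0
    refine ⟨algebraMap _ _ (n * a) / algebraMap _ _ d' + algebraMap _ _ (n * b / q),
      algebraMap _ _ (n * b % q) / algebraMap _ _ q, ?_, ?_, ?_⟩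
    · have h1 : n * b = q * (n * b / q) + n * b % q := (EuclideanDomain.div_add_mod _ _).symm
      have h2 : n = n * a * q + (q * (n * b / q) + n * b % q) * d' := by
        rw [← h1]; linear_combination -n * hab
      replace h2 := congrArg (algebraMap k[X] (RatFunc k)) h2
      rw [hd']
      simp only [map_mul, map_add] at h2 ⊢
      field_simp
      linear_combination h2
    · refine (Valuation.map_add _ _ _).trans (max_le ?_ (valuation_finite_algebraMap_le_one _ _))
      rw [map_div₀, (valuation_finite_algebraMap_eq_one (f := d')).mpr, div_one]
      · exact valuation_finite_algebraMap_le_one _ _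
      · rwa [linearPrime, Ideal.mem_span_singleton]
    · rintro (p | _) h
      · obtain ⟨t', rfl⟩ := exists_eq_linearPrime p
        rw [map_div₀, (valuation_finite_algebraMap_eq_one (f := q)).mpr, div_one]
        · exact valuation_finite_algebraMap_le_one _ _
        · rw [ne_eq, ClosedPoint.finite.injEq, linearPrime_injective.eq_iff] at h
          rw [mem_linearPrime, hq, eval_pow]
          exact pow_ne_zero _ (by simpa [sub_eq_zero] using h)
      · exact valuation_infinity_div_le_one hq0 (EuclideanDomain.mod_lt _ hq0).le

/-- The ring of functions regular on `ℙ¹ ∖ {s₀}` is contained in the polynomial ring `k[τ]`, with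
`τ = T` for `s₀ = ∞` and `τ = 1 / (T - t)` for `s₀ = t`. -/
theorem exists_coordinate [IsAlgClosed k] (s₀ : ClosedPoint k) :
    ∃ τ : RatFunc k, Transcendental k τ ∧
      ∀ f : RatFunc k, (∀ s, s ≠ s₀ → s.valuation f ≤ 1) → f ∈ (aeval (R := k) τ).range := by
  cases s₀ with
  | infinity =>
    refine ⟨RatFunc.X, RatFunc.transcendental_X, fun f hf => ?_⟩
    obtain ⟨g, rfl⟩ := HeightOneSpectrum.mem_integers_of_valuation_le_one (R := k[X]) (RatFunc k) f
      fun p => hf (.finite p) (by simp)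
    exact ⟨g, by simp⟩
  | finite p =>
    obtain ⟨t, rfl⟩ := exists_eq_linearPrime p
    set σ := algebraMap k[X] (RatFunc k) (X - C t) with hσ
    have hσ0 : σ ≠ 0 := by
      rw [hσ, ne_eq, FaithfulSMul.algebraMap_eq_zero_iff]
      exact X_sub_C_ne_zero t
    refine ⟨σ⁻¹, ?_, fun f hf => ?_⟩
    · have hX : (RatFunc.X : RatFunc k) = σ + algebraMap k (RatFunc k) t := by
        simp [hσ]
      intro halg
      refine RatFunc.transcendental_X (K := k) ?_
      rw [hX]
      exact (IsAlgebraic.inv_iff.mp halg).add (isAlgebraic_algebraMap t)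
    rcases eq_or_ne f 0 with rfl | hf0
    · exact zero_mem _
    obtain ⟨n, hn⟩ : ∃ n : ℕ, (linearPrime t).valuation (RatFunc k) (σ ^ n * f) ≤ 1 := by
      have hv : (linearPrime t).valuation (RatFunc k) f ≠ 0 := by simpa using hf0
      refine ⟨(log ((linearPrime t).valuation (RatFunc k) f)).toNat, ?_⟩
      rw [map_mul, map_pow, linearPrime_valuation_X_sub_C, ← exp_nsmul, ← exp_log hv, ← exp_add,
        log_exp, ← exp_zero, exp_le_exp]
      simp
    obtain ⟨g, hg⟩ := HeightOneSpectrum.mem_integers_of_valuation_le_one (R := k[X]) (RatFunc k)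
      (σ ^ n * f) (fun p => by
        by_cases hp : p = linearPrime t
        · rwa [hp]
        · rw [map_mul, map_pow]
          exact mul_le_one' (pow_le_one' (p.valuation_le_one _) _)
            (hf (.finite p) (by simpa using hp)))
    have hdeg : g.natDegree ≤ n := by
      have h := hf .infinity (by simp)
      have hg0 : g ≠ 0 := by
        rintro rfl
        rw [map_zero, eq_comm] at hg
        exact mul_ne_zero (pow_ne_zero n hσ0) hf0 hg
      have h2 := valuation_infinity_algebraMap hg0
      rw [hg, map_mul, map_pow, valuation_infinity_algebraMap (X_sub_C_ne_zero t),
        natDegree_X_sub_C] at h2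
      have h3 := mul_le_mul_right h (exp ((1 : ℕ) : ℤ) ^ n)
      rw [h2, mul_one, ← exp_nsmul, exp_le_exp] at h3
      simpa using h3
    let := invertibleOfNonzero hσ0
    -- `σ ^ n * f = b(σ)` with `natDegree b ≤ n`; reversing the coefficients of `b` expresses `f` as
    -- a polynomial in `σ⁻¹`
    set b := g.comp (X + C t) with hb
    have hbdeg : b.natDegree ≤ n := by rw [hb, natDegree_comp]; simpa using hdeg
    have hbg : aeval σ b = algebraMap k[X] (RatFunc k) g := by
      rw [hb, hσ, aeval_algebraMap_apply, aeval_comp]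
      simp
    refine ⟨reflect n b, ?_⟩
    have := eval₂_reflect_mul_pow (algebraMap k (RatFunc k)) σ n b hbdeg
    rw [invOf_eq_inv] at this
    refine mul_right_cancel₀ (pow_ne_zero n hσ0) ?_
    refine this.trans ?_
    rw [← aeval_def, hbg, hg, mul_comm]

/-- A rational function without poles is constant. -/
theorem mem_range_algebraMap_of_forall_valuation_le_one {f : RatFunc k}
    (hf : ∀ s : ClosedPoint k, s.valuation f ≤ 1) : f ∈ (algebraMap k (RatFunc k)).range := by
  obtain ⟨g, rfl⟩ := HeightOneSpectrum.mem_integers_of_valuation_le_one (R := k[X]) (RatFunc k) f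
    fun p => hf (.finite p)
  rcases eq_or_ne g 0 with rfl | hg
  · exact ⟨0, by simp⟩
  have h := hf .infinity
  rw [valuation_infinity_algebraMap hg, ← exp_zero, exp_le_exp] at h
  have h0 : g.natDegree = 0 := by omega
  rw [eq_C_of_natDegree_eq_zero h0]
  exact ⟨_, by rw [IsScalarTower.algebraMap_apply k k[X] (RatFunc k)]; rfl⟩

/-- A rational function without zeros and poles on the affine line has none at infinity. -/
theorem valuation_infinity_eq_one_of_forall {f : RatFunc k}
    (hf : ∀ p, (ClosedPoint.finite p).valuation f = 1) :
    (ClosedPoint.infinity : ClosedPoint k).valuation f = 1 := by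
  obtain ⟨g, hg⟩ := HeightOneSpectrum.mem_integers_of_valuation_le_one (R := k[X]) (RatFunc k) f
    fun p => (hf p).le
  obtain ⟨g', hg'⟩ := HeightOneSpectrum.mem_integers_of_valuation_le_one (R := k[X]) (RatFunc k) f⁻¹
    fun p => by rw [map_inv₀]; exact (inv_eq_one.mpr (hf p)).le
  have hf0 : f ≠ 0 := by
    rintro rfl
    simpa using hf (linearPrime 0)
  have hunit : IsUnit g := by
    refine IsUnit.of_mul_eq_one g' (FaithfulSMul.algebraMap_injective k[X] (RatFunc k) ?_)
    rw [map_mul, hg, hg', map_one, mul_inv_cancel₀ hf0]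
  rw [← hg, valuation_infinity_algebraMap hunit.ne_zero, natDegree_eq_zero_of_isUnit hunit]
  simp

theorem valuation_algebraMap_le_one (s : ClosedPoint k) (a : k) :
    s.valuation (algebraMap k (RatFunc k) a) ≤ 1 := by
  rw [IsScalarTower.algebraMap_apply k k[X] (RatFunc k)]
  rcases eq_or_ne a 0 with rfl | ha
  · simp
  cases s with
  | finite p => exact valuation_finite_algebraMap_le_one _ _
  | infinity =>
    rw [valuation_infinity_algebraMap (by simpa using ha)]
    simp

theorem valuation_infinity_X :
    (ClosedPoint.infinity : ClosedPoint k).valuation RatFunc.X = exp 1 := by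
  simp [ClosedPoint.valuation]

theorem valuation_finite_X_le_one (p : HeightOneSpectrum k[X]) :
    (ClosedPoint.finite p).valuation RatFunc.X ≤ 1 := by
  rw [← RatFunc.algebraMap_X]
  exact valuation_finite_algebraMap_le_one p X

/-! ### Models that are smooth at a closed point -/

/-- The Weierstrass equation `W` itself has coefficients in `𝒪_s` and discriminant in `𝒪_sˣ`. This
is a property of the equation, not of its isomorphism class; it is encoded by a lift of `W` to an
elliptic curve over `𝒪_s`. -/
def IsSmoothAt (W : WeierstrassCurve (RatFunc k)) (s : ClosedPoint k) : Prop :=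
  ∃ W₀ : WeierstrassCurve s.localRing, W₀.IsElliptic ∧ W₀.map (algebraMap _ (RatFunc k)) = W

theorem isUnit_localRing_iff {s : ClosedPoint k} {x : s.localRing} :
    IsUnit x ↔ s.valuation x = 1 :=
  (Valuation.integer.integers s.valuation).isUnit_iff_valuation_eq_one

theorem isSmoothAt_iff {W : WeierstrassCurve (RatFunc k)} {s : ClosedPoint k} :
    IsSmoothAt W s ↔ (s.valuation W.a₁ ≤ 1 ∧ s.valuation W.a₂ ≤ 1 ∧ s.valuation W.a₃ ≤ 1 ∧
      s.valuation W.a₄ ≤ 1 ∧ s.valuation W.a₆ ≤ 1) ∧ s.valuation W.Δ = 1 := by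
  constructor
  · rintro ⟨W₀, h, rfl⟩
    refine ⟨⟨W₀.a₁.2, W₀.a₂.2, W₀.a₃.2, W₀.a₄.2, W₀.a₆.2⟩, ?_⟩
    rw [map_Δ]
    exact isUnit_localRing_iff.mp W₀.isUnit_Δ
  · rintro ⟨⟨h1, h2, h3, h4, h6⟩, h⟩
    let W₀ : WeierstrassCurve s.localRing := ⟨⟨_, h1⟩, ⟨_, h2⟩, ⟨_, h3⟩, ⟨_, h4⟩, ⟨_, h6⟩⟩
    have hW : W₀.map (algebraMap _ (RatFunc k)) = W := rfl
    refine ⟨W₀, (isElliptic_iff _).mpr (isUnit_localRing_iff.mpr ?_), hW⟩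
    rw [← h, ← hW, map_Δ]
    rfl

theorem IsSmoothAt.smul {W : WeierstrassCurve (RatFunc k)} {s : ClosedPoint k}
    (h : IsSmoothAt W s) {C : VariableChange (RatFunc k)} (hu : s.valuation C.u = 1)
    (hr : s.valuation C.r ≤ 1) (hs : s.valuation C.s ≤ 1) (ht : s.valuation C.t ≤ 1) :
    IsSmoothAt (C • W) s := by
  obtain ⟨W₀, hW, rfl⟩ := h
  obtain ⟨v, hv⟩ := isUnit_localRing_iff (x := (⟨C.u, hu.le⟩ : s.localRing)).mpr hu
  let C₀ : VariableChange s.localRing := ⟨v, ⟨_, hr⟩, ⟨_, hs⟩, ⟨_, ht⟩⟩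
  have hC : C₀.map (algebraMap _ (RatFunc k)) = C := by
    ext
    · exact congrArg Subtype.val hv
    all_goals rfl
  exact ⟨C₀ • W₀, inferInstance, by rw [← map_variableChange, hC]⟩

/-- An integral equation with unit discriminant is automatically minimal. -/
theorem hasGoodReductionAt_iff {E : WeierstrassCurve (RatFunc k)} {s : ClosedPoint k} :
    HasGoodReductionAt E s ↔ ∃ C : VariableChange (RatFunc k), IsSmoothAt (C • E) s := by
  refine exists_congr fun C => ?_
  generalize C • E = W
  constructor
  · intro h
    refine ⟨W.integralModel s.localRing, ?_, baseChange_integralModel_eq _ _⟩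
    have := h.goodReduction
    rw [← integralModel_Δ_eq s.localRing, HeightOneSpectrum.valuation_eq_one_iff_notMem] at this
    exact (isElliptic_iff _).mpr (IsLocalRing.notMem_maximalIdeal.mp this)
  · rintro ⟨W₀, hW, rfl⟩
    have hval : (IsDiscreteValuationRing.maximalIdeal s.localRing).valuation (RatFunc k)
        (W₀.map (algebraMap s.localRing (RatFunc k))).Δ = 1 := by
      rw [map_Δ, HeightOneSpectrum.valuation_eq_one_iff_notMem]
      exact IsLocalRing.notMem_maximalIdeal.mpr W₀.isUnit_Δ
    have hint : IsIntegral s.localRing (W₀.map (algebraMap s.localRing (RatFunc k))) := ⟨W₀, rfl⟩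
    refine { val_Δ_maximal := ⟨by simpa only [one_smul], fun C _ _ => ?_⟩, goodReduction := hval }
    simp only [one_smul]
    rw [← Subtype.coe_le_coe, valuation_Δ_aux_eq_of_isIntegral _ (W₀.map _), hval]
    exact (valuation_Δ_aux _ _).2

/-- A change of variables `C` that makes `W` smooth at `s` can be replaced by one whose scaling
factor is any prescribed `w` with `v_s(w) = v_s(u)`, and which keeps `W` smooth at all other points
where it is smooth and `w` is a unit. The `r`, `s`, `t` of the new change of variables are `w ^ 2`,
`w`, `w ^ 3` times the principal parts at `s` of the suitably scaled old ones. -/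
theorem exists_smul_isSmoothAt [IsAlgClosed k] {W : WeierstrassCurve (RatFunc k)}
    {s : ClosedPoint k} {C : VariableChange (RatFunc k)} (hC : IsSmoothAt (C • W) s)
    {w : RatFunc k} (hw : s.valuation w = s.valuation C.u) :
    ∃ D : VariableChange (RatFunc k), IsSmoothAt (D • W) s ∧
      ∀ s', s' ≠ s → s'.valuation w = 1 → IsSmoothAt W s' → IsSmoothAt (D • W) s' := by
  have hu0 : (C.u : RatFunc k) ≠ 0 := C.u.ne_zero
  have hw0 : w ≠ 0 := by
    rintro rfl
    rw [map_zero, eq_comm, Valuation.zero_iff] at hw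
    exact hu0 hw
  obtain ⟨g₁, r, hr, hg₁, hr'⟩ := exists_add_of_closedPoint s (C.r / w ^ 2)
  obtain ⟨g₂, σ, hσ, hg₂, hσ'⟩ := exists_add_of_closedPoint s (C.s / w)
  obtain ⟨g₃, t, ht, hg₃, ht'⟩ :=
    exists_add_of_closedPoint s ((C.t - (w / C.u) ^ 2 * g₁ * C.s * C.u ^ 2) / w ^ 3)
  have hv : s.valuation (w / C.u) = 1 := by
    rw [map_div₀, hw, div_self ((Valuation.ne_zero_iff _).mpr hu0)]
  -- `D = G * C`, where `G` is defined over `𝒪_s`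
  let G : VariableChange (RatFunc k) :=
    ⟨Units.mk0 w hw0 / C.u, -((w / C.u) ^ 2 * g₁), -(w / C.u * g₂), -((w / C.u) ^ 3 * g₃)⟩
  let D : VariableChange (RatFunc k) := ⟨Units.mk0 w hw0, w ^ 2 * r, w * σ, w ^ 3 * t⟩
  have hD : D = G * C := by
    rw [VariableChange.mul_def]
    ext
    · simp [D, G]
    · simp only [D, G]
      field_simp at hr ⊢
      linear_combination -hr
    · simp only [D, G]
      field_simp at hσ ⊢
      linear_combination -hσ
    · simp only [D, G]
      field_simp at ht ⊢
      linear_combination -ht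
  refine ⟨D, ?_, fun s' hs' hw' h => h.smul hw' ?_ ?_ ?_⟩
  · rw [hD, mul_smul]
    refine hC.smul ?_ ?_ ?_ ?_
    · simpa [G] using hv
    all_goals simp only [G, Valuation.map_neg, map_mul, map_pow, hv, one_pow, one_mul]; assumption
  all_goals simp only [D, map_mul, map_pow, hw', one_pow, one_mul]
  exacts [hr' s' hs', hσ' s' hs', ht' s' hs']

theorem finite_setOf_not_isSmoothAt (W : WeierstrassCurve (RatFunc k)) [W.IsElliptic] :
    {s | ¬ IsSmoothAt W s}.Finite := by
  have key : ∀ f : RatFunc k, {s : ClosedPoint k | ¬ s.valuation f ≤ 1}.Finite := by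
    intro f
    rcases eq_or_ne f 0 with rfl | hf
    · simp
    · exact (finite_setOf_valuation_ne_one hf).subset fun s hs h => hs h.le
  refine (((key W.a₁).union <| (key W.a₂).union <| (key W.a₃).union <| (key W.a₄).union <|
    (key W.a₆).union (finite_setOf_valuation_ne_one W.isUnit_Δ.ne_zero))).subset fun s hs => ?_
  have hs : ¬ IsSmoothAt W s := hs
  rw [isSmoothAt_iff] at hs
  simp only [Set.mem_union, Set.mem_ofPred_eq]
  tauto

/-- Good reduction away from `s₀` can be realised at all points `s ≠ s₀` by one equation. -/
theorem exists_smul_isSmoothAt_of_ne [IsAlgClosed k] (E : WeierstrassCurve (RatFunc k))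
    [E.IsElliptic] {s₀ : ClosedPoint k} (hE : ∀ s, s ≠ s₀ → HasGoodReductionAt E s) :
    ∃ C : VariableChange (RatFunc k), ∀ s, s ≠ s₀ → IsSmoothAt (C • E) s := by
  -- induction on the finite set `F` of points at which the equation has to be repaired
  have key : ∀ F : Set (ClosedPoint k), F.Finite → s₀ ∉ F →
      ∃ C : VariableChange (RatFunc k), ∀ s, s ≠ s₀ → s ∈ F ∨ IsSmoothAt E s →
        IsSmoothAt (C • E) s := by
    intro F hF
    induction F, hF using Set.Finite.induction_on with
    | empty => exact fun _ => ⟨1, fun s _ h => by simpa using h⟩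
    | @insert s F hs hF ih =>
      intro h
      rw [Set.mem_insert_iff, not_or] at h
      obtain ⟨C, hC⟩ := ih h.2
      obtain ⟨C', hC'⟩ := hasGoodReductionAt_iff.mp (hE s (Ne.symm h.1))
      obtain ⟨π, hπ, hπ'⟩ := exists_uniformizer (Ne.symm h.1)
      have hCC : IsSmoothAt ((C' * C⁻¹) • C • E) s := by rwa [mul_smul, inv_smul_smul]
      have hu : s.valuation (C' * C⁻¹).u ≠ 0 := (Valuation.ne_zero_iff _).mpr (Units.ne_zero _)
      obtain ⟨D, hD, hD'⟩ := exists_smul_isSmoothAt hCC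
        (w := π ^ (-log (s.valuation (C' * C⁻¹).u))) (by
          rw [map_zpow₀, hπ, ← exp_zsmul]
          simp [exp_log hu])
      refine ⟨D * C, fun s' hs' hs'F => ?_⟩
      rw [mul_smul]
      by_cases hss : s' = s
      · rwa [hss]
      · refine hD' s' hss (by rw [map_zpow₀, hπ' s' hss hs', one_zpow]) (hC s' hs' ?_)
        simpa [hss] using hs'F
  obtain ⟨C, hC⟩ := key _ ((finite_setOf_not_isSmoothAt E).sdiff (t := {s₀})) (by simp)
  refine ⟨C, fun s hs => hC s hs ?_⟩
  by_cases h : IsSmoothAt E s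
  · exact Or.inr h
  · exact Or.inl ⟨h, hs⟩

/-! ### Lower bounds for the number of bad points -/

theorem isConstant_of_forall_hasGoodReductionAt [IsAlgClosed k] (E : WeierstrassCurve (RatFunc k))
    [E.IsElliptic] (hE : ∀ s, HasGoodReductionAt E s) : IsConstant E := by
  obtain ⟨C, hC⟩ := exists_smul_isSmoothAt_of_ne E (s₀ := .infinity) fun s _ => hE s
  obtain ⟨C', hC'⟩ := hasGoodReductionAt_iff.mp (hE .infinity)
  have hCC : IsSmoothAt ((C' * C⁻¹) • C • E) .infinity := by rwa [mul_smul, inv_smul_smul]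
  have hΔ : ClosedPoint.infinity.valuation (C • E).Δ = 1 :=
    valuation_infinity_eq_one_of_forall fun p => (isSmoothAt_iff.mp (hC (.finite p) (by simp))).2
  have hu : ClosedPoint.infinity.valuation ((C' * C⁻¹).u : RatFunc k) = 1 := by
    have h := (isSmoothAt_iff.mp hCC).2
    rw [variableChange_Δ, map_mul, hΔ, mul_one, map_pow, Units.val_inv_eq_inv_val, map_inv₀,
      inv_pow, inv_eq_one] at h
    exact (pow_eq_one_iff_of_nonneg zero_le (by norm_num)).mp h
  -- no scaling is needed at infinity, so the correction there does not affect any finite point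
  obtain ⟨D, hD, hD'⟩ := exists_smul_isSmoothAt hCC (w := 1) (by rw [map_one, hu])
  have hall : ∀ s, IsSmoothAt ((D * C) • E) s := fun s => by
    rw [mul_smul]
    by_cases hs : s = .infinity
    · rwa [hs]
    · exact hD' s hs (map_one _) (hC s hs)
  simp only [isSmoothAt_iff] at hall
  obtain ⟨a₁, h₁⟩ := mem_range_algebraMap_of_forall_valuation_le_one fun s => (hall s).1.1
  obtain ⟨a₂, h₂⟩ := mem_range_algebraMap_of_forall_valuation_le_one fun s => (hall s).1.2.1
  obtain ⟨a₃, h₃⟩ := mem_range_algebraMap_of_forall_valuation_le_one fun s => (hall s).1.2.2.1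
  obtain ⟨a₄, h₄⟩ := mem_range_algebraMap_of_forall_valuation_le_one fun s => (hall s).1.2.2.2.1
  obtain ⟨a₆, h₆⟩ := mem_range_algebraMap_of_forall_valuation_le_one fun s => (hall s).1.2.2.2.2
  exact ⟨D * C, ⟨a₁, a₂, a₃, a₄, a₆⟩,
    by ext <;> simp only [map_a₁, map_a₂, map_a₃, map_a₄, map_a₆, *]⟩

/-- If `E` has good reduction away from one point, it has an equation over a polynomial ring, with
discriminant in `kˣ`: the polynomial ring is that of functions regular away from the point. -/
theorem exists_polynomial_model [IsAlgClosed k] (E : WeierstrassCurve (RatFunc k))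
    [E.IsElliptic] {s₀ : ClosedPoint k} (hE : ∀ s, s ≠ s₀ → HasGoodReductionAt E s) :
    ∃ (C : VariableChange (RatFunc k)) (φ : k[X] →ₐ[k] RatFunc k) (W : WeierstrassCurve k[X])
      (c : k), C • E = W.map φ.toRingHom ∧ c ≠ 0 ∧ W.Δ = Polynomial.C c := by
  obtain ⟨C, hC⟩ := exists_smul_isSmoothAt_of_ne E hE
  obtain ⟨τ, hτ, hmem⟩ := exists_coordinate s₀
  simp only [isSmoothAt_iff] at hC
  obtain ⟨a₁, h₁⟩ := hmem _ fun s hs => (hC s hs).1.1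
  obtain ⟨a₂, h₂⟩ := hmem _ fun s hs => (hC s hs).1.2.1
  obtain ⟨a₃, h₃⟩ := hmem _ fun s hs => (hC s hs).1.2.2.1
  obtain ⟨a₄, h₄⟩ := hmem _ fun s hs => (hC s hs).1.2.2.2.1
  obtain ⟨a₆, h₆⟩ := hmem _ fun s hs => (hC s hs).1.2.2.2.2
  obtain ⟨d, hd⟩ := hmem (C • E).Δ⁻¹ fun s hs => by rw [map_inv₀, (hC s hs).2, inv_one]
  let W : WeierstrassCurve k[X] := ⟨a₁, a₂, a₃, a₄, a₆⟩
  have hW : C • E = W.map (aeval τ).toRingHom := by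
    ext
    exacts [h₁.symm, h₂.symm, h₃.symm, h₄.symm, h₆.symm]
  have hunit : IsUnit W.Δ := by
    refine IsUnit.of_mul_eq_one d (transcendental_iff_injective.mp hτ ?_)
    rw [map_mul, map_one]
    have h : (aeval τ) W.Δ = (C • E).Δ := by rw [hW, map_Δ]; rfl
    rw [h]
    exact (congrArg _ hd).trans (mul_inv_cancel₀ (C • E).isUnit_Δ.ne_zero)
  obtain ⟨c, hc, hcW⟩ := Polynomial.isUnit_iff.mp hunit
  exact ⟨C, aeval τ, W, c, hW, hc.ne_zero, hcW.symm⟩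

/-- `c₄` is `a₁ ^ 4` in characteristic 2 and `b₂ ^ 2` in characteristic 3. -/
theorem natDegree_c₄_eq_zero [IsAlgClosed k] (hchar : CharP k 2 ∨ CharP k 3)
    {W : WeierstrassCurve k[X]} {c : k} (hc : c ≠ 0) (hΔ : W.Δ = C c) : W.c₄.natDegree = 0 := by
  rcases hchar with _ | _
  · have h2 : (2 : k[X]) = 0 := CharP.cast_eq_zero k[X] 2
    have h : W.c₄ = W.a₁ ^ 4 := by
      rw [WeierstrassCurve.c₄, WeierstrassCurve.b₂]
      linear_combination (4 * W.a₁ ^ 2 * W.a₂ + 8 * W.a₂ ^ 2 - 12 * W.b₄) * h2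
    rw [h, natDegree_pow, natDegree_a₁_eq_zero_of_charP_two hc hΔ]
  · have h3 : (3 : k[X]) = 0 := CharP.cast_eq_zero k[X] 3
    have h : W.c₄ = W.b₂ ^ 2 := by
      rw [WeierstrassCurve.c₄]
      linear_combination -8 * W.b₄ * h3
    rw [h, natDegree_pow, natDegree_b₂_eq_zero_of_charP_three hc hΔ]

theorem hasConstantJ_of_forall_ne [IsAlgClosed k] (hchar : CharP k 2 ∨ CharP k 3)
    (E : WeierstrassCurve (RatFunc k)) [E.IsElliptic] {s₀ : ClosedPoint k}
    (hE : ∀ s, s ≠ s₀ → HasGoodReductionAt E s) : HasConstantJ E := by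
  obtain ⟨D, φ, W, c, hW, hc, hΔ⟩ := exists_polynomial_model E hE
  have hφ : ∀ a : k, φ (C a) = algebraMap k (RatFunc k) a := fun a => φ.commutes a
  refine ⟨c⁻¹ * W.c₄.coeff 0 ^ 3, ?_⟩
  have h1 : (D • E).c₄ = algebraMap k (RatFunc k) (W.c₄.coeff 0) := by
    rw [hW, map_c₄, ← hφ]
    exact congrArg φ (eq_C_of_natDegree_eq_zero (natDegree_c₄_eq_zero hchar hc hΔ))
  have h2 : (D • E).Δ = algebraMap k (RatFunc k) c := by
    rw [hW, map_Δ, hΔ, ← hφ]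
    rfl
  rw [← variableChange_j E D, j, Units.val_inv_eq_inv_val, coe_Δ', h1, h2]
  simp

theorem two_le_encard_badPoints [IsAlgClosed k] (hchar : CharP k 2 ∨ CharP k 3)
    (E : WeierstrassCurve (RatFunc k)) [E.IsElliptic] (hE : ¬ HasConstantJ E) :
    2 ≤ (badPoints E).encard := by
  by_contra! h
  have h1 : (badPoints E).encard ≤ 1 := Order.le_of_lt_add_one h
  rw [Set.encard_le_one_iff_subsingleton] at h1
  obtain ⟨s₀, hs₀⟩ : ∃ s₀, badPoints E ⊆ {s₀} := by
    rcases h1.eq_empty_or_singleton with h | ⟨s₀, h⟩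
    · exact ⟨.infinity, by simp [h]⟩
    · exact ⟨s₀, h.le⟩
  exact hE (hasConstantJ_of_forall_ne hchar E fun s hs => by_contra fun h => hs (hs₀ h))

theorem one_le_encard_badPoints [IsAlgClosed k]
    (E : WeierstrassCurve (RatFunc k)) [E.IsElliptic] (hE : ¬ IsConstant E) :
    1 ≤ (badPoints E).encard := by
  rw [Set.one_le_encard_iff_nonempty]
  by_contra h
  rw [Set.not_nonempty_iff_eq_empty] at h
  exact hE (isConstant_of_forall_hasGoodReductionAt E fun s => by_contra fun hs =>
    (h.le hs : s ∈ (∅ : Set _)))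

/-! ### Curves attaining the bounds -/

theorem IsConstant.hasGoodReductionAt {E : WeierstrassCurve (RatFunc k)} [E.IsElliptic]
    (h : IsConstant E) (s : ClosedPoint k) : HasGoodReductionAt E s := by
  obtain ⟨C, W, hW⟩ := h
  refine hasGoodReductionAt_iff.mpr ⟨C, isSmoothAt_iff.mpr ?_⟩
  have hΔ : (C • E).Δ ≠ 0 := (C • E).isUnit_Δ.ne_zero
  rw [hW] at hΔ ⊢
  refine ⟨⟨?_, ?_, ?_, ?_, ?_⟩, ?_⟩
  any_goals exact valuation_algebraMap_le_one s _
  refine le_antisymm (by rw [map_Δ]; exact valuation_algebraMap_le_one s _) ?_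
  rw [← inv_le_one₀ (by simpa [zero_lt_iff] using hΔ), ← map_inv₀, map_Δ, ← map_inv₀]
  exact valuation_algebraMap_le_one s _

/-- `f ^ q + ε * f + T` always has a pole at infinity: its pole order is `1` if `f` is regular
there, and `q` times that of `f` otherwise. -/
theorem one_lt_valuation_infinity_pow_add {q : ℕ} (hq : 2 ≤ q) {ε : RatFunc k}
    (hε : ClosedPoint.infinity.valuation ε ≤ 1) (f : RatFunc k) :
    1 < ClosedPoint.infinity.valuation (f ^ q + ε * f + RatFunc.X) := by
  set v := (ClosedPoint.infinity : ClosedPoint k).valuation with hv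
  have hX : v RatFunc.X = exp 1 := valuation_infinity_X
  rcases le_or_gt (v f) 1 with hf | hf
  · rw [Valuation.map_add_eq_of_lt_right, hX, ← exp_zero, exp_lt_exp]
    · exact one_pos
    · refine ((v.map_add _ _).trans (max_le ?_ ?_)).trans_lt (b := 1) ?_
      · rw [map_pow]; exact pow_le_one' hf q
      · rw [map_mul]; exact mul_le_one' hε hf
      · rw [hX, ← exp_zero, exp_lt_exp]; exact one_pos
  · have hf0 : v f ≠ 0 := (zero_lt_one.trans hf).ne'
    have h1 : exp 1 ≤ v f := by
      rw [← exp_log hf0, ← exp_zero, exp_lt_exp] at hf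
      rw [← exp_log hf0, exp_le_exp]
      omega
    have h2 : v f < v (f ^ q) := by
      rw [map_pow]
      exact lt_self_pow₀ hf (by omega)
    rw [add_assoc, Valuation.map_add_eq_of_lt_left]
    · exact hf.trans h2
    · refine (v.map_add _ _).trans_lt (max_lt ?_ ?_)
      · rw [map_mul]
        exact (mul_le_of_le_one_left' hε).trans_lt h2
      · rw [hX]; exact h1.trans_lt h2

/-- If the discriminant is `1`, a change of variables to a smooth equation at infinity is scaled by
a unit. -/
theorem exists_isSmoothAt_infinity_of_Δ_eq_one {E : WeierstrassCurve (RatFunc k)} (hΔ : E.Δ = 1)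
    (h : HasGoodReductionAt E .infinity) :
    ∃ (u : (RatFunc k)ˣ) (r s t : RatFunc k),
      ClosedPoint.infinity.valuation (u : RatFunc k) = 1 ∧
      IsSmoothAt ((⟨u, r, s, t⟩ : VariableChange (RatFunc k)) • E) .infinity := by
  obtain ⟨⟨u, r, s, t⟩, hC⟩ := hasGoodReductionAt_iff.mp h
  refine ⟨u, r, s, t, ?_, hC⟩
  have h := (isSmoothAt_iff.mp hC).2
  rw [variableChange_Δ, hΔ, mul_one, map_pow, Units.val_inv_eq_inv_val, map_inv₀, inv_pow,
    inv_eq_one] at h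
  exact (pow_eq_one_iff_of_nonneg zero_le (by norm_num)).mp h

theorem hasGoodReductionAt_of_isSmoothAt {E : WeierstrassCurve (RatFunc k)} {s : ClosedPoint k}
    (h : IsSmoothAt E s) : HasGoodReductionAt E s :=
  hasGoodReductionAt_iff.mpr ⟨1, by rwa [one_smul]⟩

/-- The curve `y² + xy = x³ + T`, whose discriminant is `-T - 432 T²` in any characteristic. -/
theorem exists_not_hasConstantJ [IsAlgClosed k] (hchar : CharP k 2 ∨ CharP k 3) :
    ∃ (E : WeierstrassCurve (RatFunc k)) (_ : E.IsElliptic),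
      ¬ HasConstantJ E ∧ (badPoints E).encard = 2 := by
  let E : WeierstrassCurve (RatFunc k) := ⟨1, 0, 0, 0, RatFunc.X⟩
  have h432 : (432 : RatFunc k) = 0 := by
    rcases hchar with _ | _
    · have := charP_of_injective_algebraMap (algebraMap k (RatFunc k)).injective 2
      have h2 : (2 : RatFunc k) = 0 := CharP.cast_eq_zero _ 2
      linear_combination 216 * h2
    · have := charP_of_injective_algebraMap (algebraMap k (RatFunc k)).injective 3
      have h3 : (3 : RatFunc k) = 0 := CharP.cast_eq_zero _ 3
      linear_combination 144 * h3
  have hΔ : E.Δ = -RatFunc.X := by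
    simp only [E, WeierstrassCurve.Δ, b₂, b₄, b₆, b₈]
    linear_combination -RatFunc.X ^ 2 * h432
  have hc₄ : E.c₄ = 1 := by simp [E, WeierstrassCurve.c₄, b₂, b₄]
  have hE : E.IsElliptic := by
    rw [isElliptic_iff, hΔ]
    exact (neg_ne_zero.mpr RatFunc.X_ne_zero).isUnit
  have hj : ¬ HasConstantJ E := by
    rintro ⟨c, hc⟩
    rw [j, Units.val_inv_eq_inv_val, coe_Δ', hΔ, hc₄] at hc
    have hX : (RatFunc.X : RatFunc k) = algebraMap k (RatFunc k) (-c⁻¹) := by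
      rw [map_neg, map_inv₀, hc]
      simp
    exact RatFunc.transcendental_X (K := k) (hX ▸ isAlgebraic_algebraMap _)
  refine ⟨E, hE, hj, le_antisymm ?_ (two_le_encard_badPoints hchar E hj)⟩
  have hsub : badPoints E ⊆ {.infinity, .finite (linearPrime 0)} := by
    rintro (p | _) hs
    · right
      by_contra hp
      refine hs (hasGoodReductionAt_of_isSmoothAt (isSmoothAt_iff.mpr ?_))
      have hX := valuation_finite_X_le_one p
      refine ⟨by simp [E, hX], ?_⟩
      rw [hΔ, Valuation.map_neg, ← RatFunc.algebraMap_X, valuation_finite_algebraMap_eq_one]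
      obtain ⟨t, rfl⟩ := exists_eq_linearPrime p
      rw [mem_linearPrime, eval_X]
      rintro rfl
      exact hp rfl
    · exact Or.inl rfl
  exact (Set.encard_le_encard hsub).trans (Set.encard_insert_le _ _ |>.trans (by simp; norm_num))

/-- The curves `y² + y = x³ + Tx` in characteristic 2 and `y² = x³ - x + T` in characteristic 3. -/
theorem exists_not_isConstant [IsAlgClosed k] (hchar : CharP k 2 ∨ CharP k 3) :
    ∃ (E : WeierstrassCurve (RatFunc k)) (_ : E.IsElliptic),
      ¬ IsConstant E ∧ (badPoints E).encard = 1 := by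
  suffices h : ∃ E : WeierstrassCurve (RatFunc k), E.Δ = 1 ∧
      (∀ p, IsSmoothAt E (.finite p)) ∧ ¬ HasGoodReductionAt E .infinity by
    obtain ⟨E, hΔ, hfin, hinf⟩ := h
    have hE : E.IsElliptic := by rw [isElliptic_iff, hΔ]; exact isUnit_one
    refine ⟨E, hE, fun h => hinf (h.hasGoodReductionAt _), Set.encard_eq_one.mpr ⟨.infinity, ?_⟩⟩
    ext (p | _)
    · simpa [badPoints] using hasGoodReductionAt_of_isSmoothAt (hfin p)
    · simpa [badPoints] using hinf
  rcases hchar with _ | _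
  · have := charP_of_injective_algebraMap (algebraMap k (RatFunc k)).injective 2
    have h2 : (2 : RatFunc k) = 0 := CharP.cast_eq_zero _ 2
    let E : WeierstrassCurve (RatFunc k) := ⟨0, 0, 1, RatFunc.X, 0⟩
    have hΔ : E.Δ = 1 := by
      simp only [E, WeierstrassCurve.Δ, b₂, b₄, b₆, b₈]
      linear_combination (-32 * RatFunc.X ^ 3 - 14) * h2
    refine ⟨E, hΔ, fun p => isSmoothAt_iff.mpr ⟨?_, by rw [hΔ, map_one]⟩, fun h => ?_⟩
    · simp [E, valuation_finite_X_le_one p]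
    obtain ⟨u, r, s, t, hu, h⟩ := exists_isSmoothAt_infinity_of_Δ_eq_one hΔ h
    obtain ⟨⟨-, h₂, -, h₄, -⟩, -⟩ := isSmoothAt_iff.mp h
    simp only [variableChange_a₂, variableChange_a₄, E, map_mul, map_pow, Units.val_inv_eq_inv_val,
      map_inv₀, hu, inv_one, one_pow, one_mul] at h₂ h₄
    -- `r ≡ s ^ 2` and `T + s + r ^ 2 ≡ 0` modulo the local ring at infinity
    refine (one_lt_valuation_infinity_pow_add (q := 4) (by norm_num) (ε := 1) (by simp) s).not_ge ?_
    set d := (0 : RatFunc k) - s * 0 + 3 * r - s ^ 2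
    rw [show s ^ 4 + 1 * s + RatFunc.X = (RatFunc.X - s * 1 + 2 * r * 0 - (t + r * s) * 0 +
      3 * r ^ 2 - 2 * s * t) - d ^ 2 by
        simp only [d]
        linear_combination (s + s * t + 3 * r ^ 2 - 3 * r * s ^ 2 + s ^ 4) * h2]
    exact (Valuation.map_sub _ _ _).trans
      (max_le h₄ (by rw [map_pow]; exact pow_le_one' h₂ 2))
  · have := charP_of_injective_algebraMap (algebraMap k (RatFunc k)).injective 3
    have h3 : (3 : RatFunc k) = 0 := CharP.cast_eq_zero _ 3
    let E : WeierstrassCurve (RatFunc k) := ⟨0, 0, 0, -1, RatFunc.X⟩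
    have hΔ : E.Δ = 1 := by
      simp only [E, WeierstrassCurve.Δ, b₂, b₄, b₆, b₈]
      linear_combination (21 - 144 * RatFunc.X ^ 2) * h3
    refine ⟨E, hΔ, fun p => isSmoothAt_iff.mpr ⟨?_, by rw [hΔ, map_one]⟩, fun h => ?_⟩
    · simp [E, valuation_finite_X_le_one p]
    obtain ⟨u, r, s, t, hu, h⟩ := exists_isSmoothAt_infinity_of_Δ_eq_one hΔ h
    obtain ⟨⟨-, -, h₃, -, h₆⟩, -⟩ := isSmoothAt_iff.mp h
    simp only [variableChange_a₃, variableChange_a₆, E, map_mul, map_pow, Units.val_inv_eq_inv_val,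
      map_inv₀, hu, inv_one, one_pow, one_mul] at h₃ h₆
    -- `t ≡ 0`, hence `r ^ 3 - r + T ≡ 0` modulo the local ring at infinity
    refine (one_lt_valuation_infinity_pow_add (q := 3) (by norm_num) (ε := -1) (by simp)
      r).not_ge ?_
    set d := (0 : RatFunc k) + r * 0 + 2 * t
    rw [show r ^ 3 + -1 * r + RatFunc.X = (RatFunc.X + r * -1 + r ^ 2 * 0 + r ^ 3 - t * 0 - t ^ 2 -
      r * t * 0) + d ^ 2 by
        simp only [d]
        linear_combination -t ^ 2 * h3]
    exact (Valuation.map_add _ _ _).trans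
      (max_le h₆ (by rw [map_pow]; exact pow_le_one' h₃ 2))

end EllipticP1

theorem theorem2 (k : Type*) [Field k] [IsAlgClosed k] (hchar : CharP k 2 ∨ CharP k 3) :
    -- (a) non-constant `j`-invariant: at least two points with bad reduction
    (∀ (E : WeierstrassCurve (RatFunc k)) [E.IsElliptic],
      ¬ EllipticP1.HasConstantJ E → 2 ≤ (EllipticP1.badPoints E).encard) ∧
    -- (b) non-constant: at least one point with bad reduction
    (∀ (E : WeierstrassCurve (RatFunc k)) [E.IsElliptic],
      ¬ EllipticP1.IsConstant E → 1 ≤ (EllipticP1.badPoints E).encard) ∧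
    -- the bound in (a) is sharp
    (∃ (E : WeierstrassCurve (RatFunc k)) (_ : E.IsElliptic),
      ¬ EllipticP1.HasConstantJ E ∧ (EllipticP1.badPoints E).encard = 2) ∧
    -- the bound in (b) is sharp
    (∃ (E : WeierstrassCurve (RatFunc k)) (_ : E.IsElliptic),
      ¬ EllipticP1.IsConstant E ∧ (EllipticP1.badPoints E).encard = 1) :=
  ⟨fun E _ => EllipticP1.two_le_encard_badPoints hchar E,
    fun E _ => EllipticP1.one_le_encard_badPoints E,
    EllipticP1.exists_not_hasConstantJ hchar, EllipticP1.exists_not_isConstant hchar⟩
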